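/- **Theorem.** Let $k \ge 4$ be fixed. In *multicolored $k$-cycle detection*, the input is an $n$-node graph $G$ with a (not necessarily proper) coloring of its nodes with $k$ colors, and the task is to decide whether $G$ contains a $k$-cycle as a subgraph all of whose nodes have different colors; in the *induced* version the $k$-cycle has to be an induced subgraph of $G$. The CONGEST model is the synchronous message-passing model on $G$: the nodes have unique identifiers $1,\dots,n$, each node initially knows $n$, its identifier, its color and the identifiers of its neighbors, local computation is unrestricted, and in each round each node may send to each neighbor a (possibly different) message of at most $b$ bits, where $b \le C\log n$ for a constant $C$. An algorithm decides correctly within $T$ rounds if after $T$ rounds at least one node reports "yes" when $G$ is a yes-instance, and no node reports "yes" when it is a no-instance. A deterministic algorithm solves the problem if it decides correctly on every input; a randomized algorithm (whose nodes may even share their random seed) solves it if on every input it decides correctly with probability at least $2/3$. Then any CONGEST algorithm, deterministic or randomized, that solves multicolored $k$-cycle detection, and any one that solves multicolored induced $k$-cycle detection, needs $\Omega(n/\log n)$ rounds. Precisely: for every $k \ge 4$ and every $C > 0$ there are $\alpha > 0$ and $n_0$ such that for all $n \ge n_0$ and all $b \le C \log n$, every such algorithm with bandwidth $b$ that solves either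 problem on $n$-node graphs within $T$ rounds satisfies $T \ge \alpha\, n/\log n$. -/

import Mathlib

open MeasureTheory

/-- Messages of the CONGEST model with bandwidth `b`: bit strings of length at most `b`
(the empty string plays the role of silence). -/
abbrev CongestMessage (b : ℕ) : Type := {w : List Bool // w.length ≤ b}

/-- A deterministic CONGEST algorithm for `n`-node networks whose nodes are labelled with one of
`k` input colors, with bandwidth `b`. The nodes are identified with their unique identifiers in
`Fin n`. All nodes run the same state machine; local computation is unrestricted, the states may
store everything seen so far, and the algorithm may depend on `n`, `k` and `b`. -/
structure CongestAlgorithm (n k b : ℕ) where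
  /-- local states of a node -/
  State : Type
  /-- state before the first round, computed from the identifier of the node, its input color, and
  the set of identifiers of its neighbors -/
  start : Fin n → Fin k → Set (Fin n) → State
  /-- `send s u` is the message that a node in state `s` sends in this round to its neighbor `u`
  (different neighbors may get different messages) -/
  send : State → Fin n → CongestMessage b
  /-- state update at the end of a round; the second argument gives, for each neighbor, the message
  received from it (`none` for the nodes that are not neighbors) -/
  receive : State → (Fin n → Option (CongestMessage b)) → State
  /-- current output of a node: `true` means that the node reports a yes-instance -/
  output : State → Bool

/-- A decision problem on `n`-node graphs with a (not necessarily proper) `k`-coloring. -/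
abbrev ColoredGraphProblem (n k : ℕ) : Type := SimpleGraph (Fin n) → (Fin n → Fin k) → Prop

namespace CongestAlgorithm

variable {n k b : ℕ}

open Classical in
/-- The state of every node after `t` synchronous rounds on the graph `G` with coloring `c`. In each
round messages travel along the edges of `G`, in both directions, and only there. -/
noncomputable def stateAfter (A : CongestAlgorithm n k b) (G : SimpleGraph (Fin n))
    (c : Fin n → Fin k) : ℕ → Fin n → A.State
  | 0, v => A.start v (c v) (G.neighborSet v)
  | t + 1, v => A.receive (A.stateAfter G c t v) fun u =>
      if G.Adj u v then some (A.send (A.stateAfter G c t u) v) else none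

/-- After `T` rounds, at least one node reports a yes-instance. -/
def AcceptsIn (A : CongestAlgorithm n k b) (T : ℕ) (G : SimpleGraph (Fin n))
    (c : Fin n → Fin k) : Prop :=
  ∃ v, A.output (A.stateAfter G c T v) = true

/-- `A` solves the problem `P` deterministically in `T` rounds: after `T` rounds some node reports
a yes-instance if the input is one, and no node does if it is not. -/
def SolvesIn (A : CongestAlgorithm n k b) (T : ℕ) (P : ColoredGraphProblem n k) : Prop :=
  ∀ G c, A.AcceptsIn T G c ↔ P G c

/-- The randomized algorithm `A`, which draws `ω` from `μ` and runs `A ω`, solves `P` in `T` rounds: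
on every input the outputs after `T` rounds are correct with probability at least `2/3`.
The random seed `ω` is available to all nodes; private coins are the special case in which `ω` is a
family of independent seeds, one for each identifier, and each node only uses its own seed. -/
def RandomizedSolvesIn {Ω : Type*} [MeasurableSpace Ω] (μ : Measure Ω)
    (A : Ω → CongestAlgorithm n k b) (T : ℕ) (P : ColoredGraphProblem n k) : Prop :=
  ∀ G c, MeasurableSet {ω | (A ω).AcceptsIn T G c ↔ P G c} ∧
    2 / 3 ≤ μ {ω | (A ω).AcceptsIn T G c ↔ P G c}

end CongestAlgorithm

/-- `G` contains a `k`-cycle as a (not necessarily induced) subgraph, all of whose nodes have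
different colors under the `k`-coloring `c`. -/
def HasMulticoloredCycle (n k : ℕ) : ColoredGraphProblem n k := fun G c =>
  ∃ φ : SimpleGraph.Copy (SimpleGraph.cycleGraph k) G, Function.Injective fun i => c (φ i)

/-- `G` contains a `k`-cycle as an induced subgraph, all of whose nodes have different colors under
the `k`-coloring `c`. -/
def HasMulticoloredInducedCycle (n k : ℕ) : ColoredGraphProblem n k := fun G c =>
  ∃ φ : SimpleGraph.cycleGraph k ↪g G, Function.Injective fun i => c (φ i)

/-!
A `k`-cycle with one node of each color in a cyclically layered graph on `k * m` nodes picks one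
node per layer. If two bipartite graphs between consecutive layers encode `x` and, read backwards,
`y`, both in `{0, 1} ^ (m ^ 2)`, and all other layers are joined by matchings, then such a cycle
exists iff `x` and `y` intersect, and it is automatically induced. Only `O(m)` matching edges
separate the two bipartite graphs, so a `T`-round algorithm gives a protocol for set disjointness on
`m ^ 2` elements that exchanges `O(b * m * T)` bits.

Randomized protocols for disjointness of subsets of `ι` need `Ω(|ι|)` bits. On inputs that are
disjoint except possibly at a hidden element `j`, the four laws of the transcript, one for each pair
of bits at `j`, are products `α u * β v`. By cut-and-paste, the Hellinger distance between the laws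
at `11` and `00`, which correctness keeps large, is controlled by those between `00` and `10` and
between `00` and `01`. The level-one inequality and the bound `log |L|` on the entropy of the
transcript show that the sum of the latter over all `j` is at most linear in `log |L|`.
-/

open scoped BigOperators

section Jensen

theorem map_expect_le_of_convexOn {α : Type*} {s : Set ℝ} {f : ℝ → ℝ} (hf : ConvexOn ℝ s f)
    {t : Finset α} (ht : t.Nonempty) {g : α → ℝ} (hg : ∀ i ∈ t, g i ∈ s) :
    f (𝔼 i ∈ t, g i) ≤ 𝔼 i ∈ t, f (g i) := by
  have hcard : (t.card : ℝ) ≠ 0 := by exact_mod_cast ht.card_ne_zero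
  have := hf.map_sum_le (t := t) (w := fun _ => (t.card : ℝ)⁻¹) (p := g)
    (fun _ _ => by positivity) (by simp [hcard]) hg
  simpa only [smul_eq_mul, inv_mul_eq_div, ← Finset.sum_div, ← Finset.expect_eq_sum_div_card]
    using this

lemma sum_negMulLog_le_log_card {L : Type*} [Fintype L] {p : L → ℝ} (hp : ∀ l, 0 ≤ p l)
    (hsum : ∑ l, p l = 1) : ∑ l, Real.negMulLog (p l) ≤ Real.log (Fintype.card L) := by
  have : Nonempty L := by
    by_contra h
    simp [not_nonempty_iff.1 h] at hsum
  have hcard : (0 : ℝ) < Fintype.card L := by exact_mod_cast Fintype.card_pos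
  have hjensen := map_expect_le_of_convexOn Real.concaveOn_negMulLog.neg Finset.univ_nonempty
    (g := p) fun l _ => hp l
  simp only [Pi.neg_apply, Finset.expect_neg_distrib, neg_le_neg_iff,
    Fintype.expect_eq_sum_div_card, hsum, one_div, Real.negMulLog, Real.log_inv] at hjensen
  rw [div_le_iff₀ hcard] at hjensen
  simpa [Real.negMulLog, mul_comm, hcard.ne'] using hjensen

end Jensen

section UniformLaw

variable {α L : Type*} [Fintype α] [DecidableEq L]

/-- The law of `F w` for a uniformly random `w`, as a weight function on the values of `F`. -/
noncomputable def uniformLaw (F : α → L) (l : L) : ℝ := 𝔼 w, if F w = l then 1 else 0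

lemma uniformLaw_nonneg (F : α → L) (l : L) : 0 ≤ uniformLaw F l :=
  Finset.expect_nonneg fun _ _ => by positivity

lemma sum_uniformLaw_eq_expect (s : Finset L) (F : α → L) :
    ∑ l ∈ s, uniformLaw F l = 𝔼 w, if F w ∈ s then 1 else 0 := by
  simp only [uniformLaw]
  rw [← Finset.expect_sum_comm]
  simp

lemma sum_uniformLaw [Fintype L] [Nonempty α] (F : α → L) : ∑ l, uniformLaw F l = 1 := by
  simp [sum_uniformLaw_eq_expect]

lemma dens_mul_expect [DecidableEq α] (A : Finset α) (f : α → ℝ) :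
    A.dens * 𝔼 w ∈ A, f w = 𝔼 w, if w ∈ A then f w else 0 := by
  rcases A.eq_empty_or_nonempty with rfl | hA
  · simp
  · have : (A.card : ℝ) ≠ 0 := by exact_mod_cast hA.card_ne_zero
    rw [Finset.nnratCast_dens, Finset.expect_eq_sum_div_card, Fintype.expect_eq_sum_div_card]
    simp only [Finset.sum_ite_mem, Finset.univ_inter]
    field_simp

lemma dens_mul_expect_le (A : Finset α) {f : α → ℝ} (hf : ∀ w, 0 ≤ f w) :
    A.dens * 𝔼 w ∈ A, f w ≤ 𝔼 w, f w := by
  classical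
  rw [dens_mul_expect]
  exact Finset.expect_le_expect fun w _ => by split_ifs <;> simp [hf w]

lemma uniformLaw_eq_dens (F : α → L) (l : L) :
    uniformLaw F l = (Finset.univ.filter (F · = l)).dens := by
  simp [uniformLaw, Finset.nnratCast_dens, Fintype.expect_eq_sum_div_card]

end UniformLaw

section Cube

variable {ι : Type*} [Fintype ι] [DecidableEq ι]

lemma expect_update_add_expect_update (f : (ι → Bool) → ℝ) (j : ι) :
    𝔼 w, f (Function.update w j true) + 𝔼 w, f (Function.update w j false) = 2 * 𝔼 w, f w := by
  have hflip : Function.Involutive fun w : ι → Bool => Function.update w j (!w j) :=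
    fun w => by simp
  have hsum : ∀ w : ι → Bool, f (Function.update w j true) + f (Function.update w j false) =
      f w + f (Function.update w j (!w j)) := by
    intro w
    conv_rhs => rw [← Function.update_eq_self j w]
    cases w j <;> simp [add_comm]
  rw [← Finset.expect_add_distrib, Finset.expect_congr rfl fun w _ => hsum w,
    Finset.expect_add_distrib, two_mul, add_right_inj]
  exact Fintype.expect_equiv hflip.toPerm _ _ fun _ => rfl

/-- The sign `±1` of a bit. -/
def bitSign (u : Bool) : ℝ := if u then 1 else -1

lemma expect_exp_sum_mul_bitSign_le (a : ι → ℝ) :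
    𝔼 w : ι → Bool, Real.exp (∑ j, a j * bitSign (w j)) ≤ Real.exp ((∑ j, a j ^ 2) / 2) := by
  have hprod : 𝔼 w : ι → Bool, Real.exp (∑ j, a j * bitSign (w j)) = ∏ j, Real.cosh (a j) := by
    have hcosh : ∀ j, Real.cosh (a j) = (∑ u : Bool, Real.exp (a j * bitSign u)) / 2 := fun j => by
      simp [Real.cosh_eq, bitSign]
    simp only [hcosh, Finset.prod_div_distrib, Finset.prod_univ_sum, Fintype.piFinset_univ,
      ← Real.exp_sum, Fintype.expect_eq_sum_div_card]
    simp
  rw [hprod, Finset.sum_div, Real.exp_sum]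
  exact Finset.prod_le_prod (fun j _ => (Real.cosh_pos _).le) fun j _ =>
    Real.cosh_le_exp_half_sq (a j)

/-- The average sign of the `j`-th bit over a set of bit strings. -/
noncomputable def bias (A : Finset (ι → Bool)) (j : ι) : ℝ := 𝔼 w ∈ A, bitSign (w j)

/-- The level-one inequality (Chang's lemma). -/
theorem sum_bias_sq_le {A : Finset (ι → Bool)} (hA : A.Nonempty) :
    ∑ j, bias A j ^ 2 ≤ -2 * Real.log A.dens := by
  have hdens : (0 : ℝ) < A.dens := by exact_mod_cast hA.dens_pos
  have hmean : 𝔼 w ∈ A, ∑ j, bias A j * bitSign (w j) = ∑ j, bias A j ^ 2 := by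
    rw [Finset.expect_sum_comm]
    exact Finset.sum_congr rfl fun j _ => by rw [← Finset.mul_expect, sq, bias]
  have hjensen : Real.exp (∑ j, bias A j ^ 2) ≤
      𝔼 w ∈ A, Real.exp (∑ j, bias A j * bitSign (w j)) := by
    rw [← hmean]
    exact map_expect_le_of_convexOn convexOn_exp hA fun _ _ => Set.mem_univ _
  have hexp : A.dens * Real.exp (∑ j, bias A j ^ 2) ≤ Real.exp ((∑ j, bias A j ^ 2) / 2) :=
    (mul_le_mul_of_nonneg_left hjensen hdens.le).trans <|
      (dens_mul_expect_le A fun _ => (Real.exp_pos _).le).trans (expect_exp_sum_mul_bitSign_le _)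
  have hlog := Real.log_le_log (by positivity) hexp
  rw [Real.log_mul hdens.ne' (Real.exp_pos _).ne', Real.log_exp, Real.log_exp] at hlog
  linarith

end Cube

section Hellinger

variable {L : Type*} [Fintype L]

/-- The squared Hellinger distance of two weight functions, without the customary factor `1 / 2`. -/
noncomputable def hellingerSq (p q : L → ℝ) : ℝ := ∑ l, (√(p l) - √(q l)) ^ 2

lemma hellingerSq_le_two_mul_add (p q r : L → ℝ) :
    hellingerSq p q ≤ 2 * (hellingerSq r p + hellingerSq r q) := by
  simp only [hellingerSq, ← Finset.sum_add_distrib, Finset.mul_sum]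
  gcongr with l
  linarith [sq_nonneg (√(r l) - √(p l) + (√(r l) - √(q l)))]

lemma hellingerSq_eq_of_mul_eq_mul {p q p' q' : L → ℝ} (hp : 0 ≤ p) (hq : 0 ≤ q) (hp' : 0 ≤ p')
    (hq' : 0 ≤ q') (hsum : ∑ l, p l + ∑ l, q l = ∑ l, p' l + ∑ l, q' l)
    (hmul : ∀ l, p l * q l = p' l * q' l) : hellingerSq p q = hellingerSq p' q' := by
  have hexpand : ∀ {p q : L → ℝ}, 0 ≤ p → 0 ≤ q →
      hellingerSq p q = ∑ l, p l + ∑ l, q l - 2 * ∑ l, √(p l * q l) := by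
    intro p q hp hq
    simp only [hellingerSq, Finset.mul_sum, ← Finset.sum_add_distrib, ← Finset.sum_sub_distrib]
    refine Finset.sum_congr rfl fun l _ => ?_
    rw [sub_sq, Real.sq_sqrt (hp l), Real.sq_sqrt (hq l), Real.sqrt_mul (hp l)]
    ring
  simp only [hexpand hp hq, hexpand hp' hq', hsum, hmul]

lemma sq_sum_sub_le_hellingerSq {p q : L → ℝ} (hp : 0 ≤ p) (hq : 0 ≤ q) (hp1 : ∑ l, p l = 1)
    (hq1 : ∑ l, q l = 1) (s : Finset L) : (∑ l ∈ s, (p l - q l)) ^ 2 ≤ 4 * hellingerSq p q := by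
  have hfactor : ∀ l, p l - q l = (√(p l) - √(q l)) * (√(p l) + √(q l)) := fun l => by
    linear_combination -Real.sq_sqrt (hp l) + Real.sq_sqrt (hq l)
  have hadd : ∑ l, (√(p l) + √(q l)) ^ 2 ≤ 4 := by
    calc ∑ l, (√(p l) + √(q l)) ^ 2 ≤ ∑ l, 2 * (p l + q l) := by
          gcongr with l
          linarith [sq_nonneg (√(p l) - √(q l)), Real.sq_sqrt (hp l), Real.sq_sqrt (hq l)]
      _ = 4 := by rw [← Finset.mul_sum, Finset.sum_add_distrib, hp1, hq1]; norm_num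
  calc (∑ l ∈ s, (p l - q l)) ^ 2
      = (∑ l ∈ s, (√(p l) - √(q l)) * (√(p l) + √(q l))) ^ 2 := by simp only [hfactor]
    _ ≤ (∑ l ∈ s, (√(p l) - √(q l)) ^ 2) * ∑ l ∈ s, (√(p l) + √(q l)) ^ 2 :=
        Finset.sum_mul_sq_le_sq_mul_sq ..
    _ ≤ hellingerSq p q * ∑ l, (√(p l) + √(q l)) ^ 2 := by
        rw [hellingerSq]
        gcongr <;> exact s.subset_univ
    _ ≤ 4 * hellingerSq p q := by
        rw [mul_comm]
        gcongr
        exact Finset.sum_nonneg fun l _ => sq_nonneg _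

lemma sq_sqrt_sub_sqrt_mul_add_le {a b : ℝ} (ha : 0 ≤ a) (hb : 0 ≤ b) :
    (√a - √b) ^ 2 * (a + b) ≤ (a - b) ^ 2 := by
  obtain ⟨x, hx, rfl⟩ : ∃ x, 0 ≤ x ∧ x ^ 2 = a := ⟨√a, a.sqrt_nonneg, Real.sq_sqrt ha⟩
  obtain ⟨y, hy, rfl⟩ : ∃ y, 0 ≤ y ∧ y ^ 2 = b := ⟨√b, b.sqrt_nonneg, Real.sq_sqrt hb⟩
  rw [Real.sqrt_sq hx, Real.sqrt_sq hy]
  nlinarith [mul_nonneg (sq_nonneg (x - y)) (mul_nonneg hx hy)]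

end Hellinger

section BitHellinger

variable {ι L : Type*} [Fintype ι] [DecidableEq ι] [DecidableEq L]

/-- The influence of the `j`-th bit on `F`: the squared Hellinger distance between the laws of `F`
at a uniformly random bit string after the `j`-th bit has been set to `0`, respectively to `1`. -/
noncomputable def bitHellinger [Fintype L] (F : (ι → Bool) → L) (j : ι) : ℝ :=
  hellingerSq (uniformLaw fun w => F (Function.update w j false))
    (uniformLaw fun w => F (Function.update w j true))

lemma uniformLaw_update_add (F : (ι → Bool) → L) (j : ι) (l : L) :
    uniformLaw (fun w => F (Function.update w j false)) l +
      uniformLaw (fun w => F (Function.update w j true)) l = 2 * uniformLaw F l := by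
  rw [add_comm]
  exact expect_update_add_expect_update (fun w => if F w = l then 1 else 0) j

lemma uniformLaw_update_sub (F : (ι → Bool) → L) (j : ι) (l : L) :
    uniformLaw (fun w => F (Function.update w j false)) l -
      uniformLaw (fun w => F (Function.update w j true)) l =
        -2 * (uniformLaw F l * bias (Finset.univ.filter (F · = l)) j) := by
  have h := expect_update_add_expect_update (fun w => if F w = l then bitSign (w j) else 0) j
  have hneg : 𝔼 w, (if F (Function.update w j false) = l then (-1 : ℝ) else 0) =
      -uniformLaw (fun w => F (Function.update w j false)) l := by
    rw [uniformLaw, ← Finset.expect_neg_distrib]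
    exact Finset.expect_congr rfl fun w _ => by split_ifs <;> simp
  simp only [Function.update_self, bitSign, if_true, Bool.false_eq_true, if_false, hneg] at h
  rw [uniformLaw_eq_dens F l, bias, dens_mul_expect]
  simp only [Finset.mem_filter_univ, bitSign, neg_mul, ← h, uniformLaw]
  ring

lemma sq_sqrt_uniformLaw_sub_le (F : (ι → Bool) → L) (j : ι) (l : L) :
    (√(uniformLaw (fun w => F (Function.update w j false)) l) -
      √(uniformLaw (fun w => F (Function.update w j true)) l)) ^ 2 ≤
        2 * uniformLaw F l * bias (Finset.univ.filter (F · = l)) j ^ 2 := by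
  have h₀ := uniformLaw_nonneg (fun w => F (Function.update w j false)) l
  have h₁ := uniformLaw_nonneg (fun w => F (Function.update w j true)) l
  have hadd := uniformLaw_update_add F j l
  have hsub := uniformLaw_update_sub F j l
  have hsq := sq_sqrt_sub_sqrt_mul_add_le h₀ h₁
  rw [hadd, hsub] at hsq
  rcases (uniformLaw_nonneg F l).eq_or_lt with hp | hp
  · rw [← hp, mul_zero] at hadd
    obtain ⟨hzero₀, hzero₁⟩ := (add_eq_zero_iff_of_nonneg h₀ h₁).1 hadd
    simp [← hp, hzero₀, hzero₁]
  · refine le_of_mul_le_mul_right (hsq.trans_eq ?_) (mul_pos two_pos hp)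
    ring

theorem sum_bitHellinger_le_log_card [Fintype L] (F : (ι → Bool) → L) :
    ∑ j, bitHellinger F j ≤ 4 * Real.log (Fintype.card L) := by
  have hlevel : ∀ l, uniformLaw F l * ∑ j, bias (Finset.univ.filter (F · = l)) j ^ 2 ≤
      2 * Real.negMulLog (uniformLaw F l) := by
    intro l
    rcases (Finset.univ.filter (F · = l)).eq_empty_or_nonempty with hA | hA
    · simp [uniformLaw_eq_dens, hA]
    · have h := mul_le_mul_of_nonneg_left (sum_bias_sq_le hA) (uniformLaw_nonneg F l)
      rw [← uniformLaw_eq_dens] at h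
      rw [Real.negMulLog]
      linarith
  calc ∑ j, bitHellinger F j
      ≤ ∑ j, ∑ l, 2 * uniformLaw F l * bias (Finset.univ.filter (F · = l)) j ^ 2 :=
        Finset.sum_le_sum fun j _ => Finset.sum_le_sum fun l _ => sq_sqrt_uniformLaw_sub_le F j l
    _ = 2 * ∑ l, uniformLaw F l * ∑ j, bias (Finset.univ.filter (F · = l)) j ^ 2 := by
        rw [Finset.sum_comm]
        simp only [Finset.mul_sum, mul_assoc]
    _ ≤ 2 * ∑ l, 2 * Real.negMulLog (uniformLaw F l) := by
        exact mul_le_mul_of_nonneg_left (Finset.sum_le_sum fun l _ => hlevel l) two_pos.le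
    _ ≤ 4 * Real.log (Fintype.card L) := by
        rw [← Finset.mul_sum]
        linarith [sum_negMulLog_le_log_card (uniformLaw_nonneg F) (sum_uniformLaw F)]

end BitHellinger

section Averaging

lemma exists_le_expect_of_le_integral {Ω κ : Type*} [MeasurableSpace Ω] {μ : Measure Ω}
    [IsProbabilityMeasure μ] [Fintype κ] [Nonempty κ] {f : κ → Ω → ℝ}
    (hf : ∀ i, Integrable (f i) μ) {p : ℝ} (hp : ∀ i, p ≤ ∫ ω, f i ω ∂μ) :
    ∃ ω, p ≤ 𝔼 i, f i ω := by
  have hint : ∫ ω, 𝔼 i, f i ω ∂μ = 𝔼 i, ∫ ω, f i ω ∂μ := by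
    simp only [Fintype.expect_eq_sum_div_card, integral_div, integral_finsetSum _ fun i _ => hf i]
  have hintegrable : Integrable (fun ω => 𝔼 i, f i ω) μ := by
    simp only [Fintype.expect_eq_sum_div_card]
    exact (integrable_finsetSum _ fun i _ => hf i).div_const _
  obtain ⟨ω, hω⟩ := exists_integral_le hintegrable
  exact ⟨ω, (Finset.le_expect Finset.univ_nonempty fun i _ => hp i).trans (hint.symm.trans_le hω)⟩

end Averaging

section Disjointness

/-- The combinatorial property of the transcript `tr x y` of a two-party protocol on inputs `x` and
`y` that communication lower bounds use: the inputs with a given transcript form a rectangle. -/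
def HasRectangularFibers {X Y L : Type*} (tr : X → Y → L) : Prop :=
  ∀ ⦃x y x' y'⦄, tr x y = tr x' y' → tr x y' = tr x y

lemma HasRectangularFibers.eq_iff {X Y L : Type*} {tr : X → Y → L} (htr : HasRectangularFibers tr)
    (x : X) (y : Y) (l : L) : tr x y = l ↔ (∃ y', tr x y' = l) ∧ ∃ x', tr x' y = l := by
  refine ⟨fun h => ⟨⟨y, h⟩, x, h⟩, ?_⟩
  rintro ⟨⟨y', hy'⟩, x', hx'⟩
  rw [htr (hy'.trans hx'.symm), hy']

lemma expect_inf_mul_compl_inf {B : Type*} [BooleanAlgebra B] [Fintype B] (S : B) (f g : B → ℝ) :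
    𝔼 w, f (S ⊓ w) * g (Sᶜ ⊓ w) = (𝔼 w, f (S ⊓ w)) * 𝔼 w, g (Sᶜ ⊓ w) := by
  have hswap : Function.Involutive fun w : B × B =>
      (S ⊓ w.1 ⊔ Sᶜ ⊓ w.2, S ⊓ w.2 ⊔ Sᶜ ⊓ w.1) := fun w => by
    simp [inf_sup_left, ← inf_assoc, ← inf_sup_right]
  -- Exchanging the parts outside `S` of two copies of `w` preserves the uniform law.
  calc 𝔼 w, f (S ⊓ w) * g (Sᶜ ⊓ w) = 𝔼 w : B × B, f (S ⊓ w.1) * g (Sᶜ ⊓ w.1) := by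
        rw [← Finset.univ_product_univ, Finset.expect_product]
        simp
    _ = 𝔼 w : B × B, f (S ⊓ w.1) * g (Sᶜ ⊓ w.2) :=
        (Fintype.expect_equiv hswap.toPerm _ _ fun w => by
          simp [inf_sup_left, ← inf_assoc]).symm
    _ = (𝔼 w, f (S ⊓ w)) * 𝔼 w, g (Sᶜ ⊓ w) := by
        rw [← Finset.univ_product_univ, Finset.expect_product, Finset.expect_mul_expect]

variable {ι L : Type*} [DecidableEq ι]

lemma update_inf_update (S w : ι → Bool) (j : ι) (s u : Bool) :
    Function.update S j s ⊓ Function.update w j u = Function.update (S ⊓ w) j (s ⊓ u) := by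
  ext i
  rcases eq_or_ne i j with rfl | hij <;> simp [*]

/-- The part of the bit string `w` inside `S`, with the `j`-th bit overwritten by `u`. The hard
instances of disjointness are the pairs `(planted S j u w, planted Sᶜ j u w)`, which intersect at
most in `j`. -/
def planted (S : ι → Bool) (j : ι) (u : Bool) (w : ι → Bool) : ι → Bool :=
  Function.update (S ⊓ w) j u

lemma disjoint_planted_iff (S w : ι → Bool) (j : ι) (u : Bool) :
    Disjoint (planted S j u w) (planted Sᶜ j u w) ↔ u = false := by
  rw [disjoint_iff, planted, planted, update_inf_update, inf_inf_inf_comm, inf_compl_self,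
    bot_inf_eq, inf_idem, Function.update_eq_self_iff]
  rfl

lemma compl_update (S : ι → Bool) (j : ι) (s : Bool) :
    (Function.update S j s)ᶜ = Function.update Sᶜ j sᶜ := by
  ext i
  rcases eq_or_ne i j with rfl | hij <;> simp [*]

variable [Fintype ι] [DecidableEq L]

/-- The law of the transcript on planted inputs with `j`-th bits `u` and `v`. -/
noncomputable def plantedLaw (tr : (ι → Bool) → (ι → Bool) → L) (S : ι → Bool) (j : ι)
    (u v : Bool) : L → ℝ :=
  uniformLaw fun w => tr (planted S j u w) (planted Sᶜ j v w)

variable {tr : (ι → Bool) → (ι → Bool) → L}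

lemma HasRectangularFibers.plantedLaw_eq_mul (htr : HasRectangularFibers tr) (S : ι → Bool)
    (j : ι) : ∃ α β : Bool → L → ℝ, ∀ u v l, plantedLaw tr S j u v l = α u l * β v l := by
  classical
  refine ⟨fun u l => 𝔼 w, if ∃ y, tr (planted S j u w) y = l then 1 else 0,
    fun v l => 𝔼 w, if ∃ x, tr x (planted Sᶜ j v w) = l then 1 else 0, fun u v l => ?_⟩
  refine Eq.trans ?_ (expect_inf_mul_compl_inf S
    (fun z => if ∃ y, tr (Function.update z j u) y = l then 1 else 0)
    fun z => if ∃ x, tr x (Function.update z j v) = l then 1 else 0)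
  refine Finset.expect_congr rfl fun w _ => ?_
  rw [if_congr (htr.eq_iff _ _ l) rfl rfl, ite_and, ite_mul, one_mul, zero_mul]
  rfl

/-- The gain in the probability of the event `acc` when the planted bits are flipped from `0` to
`1`. -/
noncomputable def plantedAdvantage (tr : (ι → Bool) → (ι → Bool) → L) (acc : Finset L)
    (S : ι → Bool) (j : ι) : ℝ :=
  ∑ l ∈ acc, (plantedLaw tr S j true true l - plantedLaw tr S j false false l)

lemma plantedAdvantage_eq_expect (acc : Finset L) (S : ι → Bool) (j : ι) :
    plantedAdvantage tr acc S j =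
      𝔼 w, ((if tr (planted S j true w) (planted Sᶜ j true w) ∈ acc then 1 else 0) -
        if tr (planted S j false w) (planted Sᶜ j false w) ∈ acc then 1 else 0) := by
  rw [plantedAdvantage, Finset.sum_sub_distrib, Finset.expect_sub_distrib, plantedLaw, plantedLaw,
    sum_uniformLaw_eq_expect, sum_uniformLaw_eq_expect]

theorem exists_le_expect_plantedAdvantage [Nonempty ι] {Ω : Type*} [MeasurableSpace Ω]
    {μ : Measure Ω} [IsProbabilityMeasure μ] {tr : Ω → (ι → Bool) → (ι → Bool) → L}
    {acc : Finset L} {p : ℝ}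
    (hmeas : ∀ x y, MeasurableSet {ω | tr ω x y ∈ acc ↔ ¬Disjoint x y})
    (hprob : ∀ x y, p ≤ μ.real {ω | tr ω x y ∈ acc ↔ ¬Disjoint x y}) :
    ∃ ω, 2 * p - 1 ≤ 𝔼 j, 𝔼 S, plantedAdvantage (tr ω) acc S j := by
  let correct (x y : ι → Bool) : Set Ω := {ω | tr ω x y ∈ acc ↔ ¬Disjoint x y}
  let score (i : ι × (ι → Bool) × (ι → Bool)) (u : Bool) : Ω → ℝ :=
    (correct (planted i.2.1 i.1 u i.2.2) (planted i.2.1ᶜ i.1 u i.2.2)).indicator 1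
  have hscore : ∀ i u, Integrable (score i u) μ ∧ p ≤ ∫ ω, score i u ω ∂μ := fun i u =>
    ⟨(integrable_const 1).indicator (hmeas _ _), (hprob _ _).trans_eq
      (integral_indicator_one (hmeas _ _)).symm⟩
  obtain ⟨ω, hω⟩ := exists_le_expect_of_le_integral (μ := μ) (p := 2 * p)
    (f := fun i ω => score i true ω + score i false ω)
    (fun i => (hscore i true).1.add (hscore i false).1) fun i => by
      rw [integral_add (hscore i true).1 (hscore i false).1]
      linarith [(hscore i true).2, (hscore i false).2]
  have hgain : ∀ i, score i true ω + score i false ω = 1 +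
      ((if tr ω (planted i.2.1 i.1 true i.2.2) (planted i.2.1ᶜ i.1 true i.2.2) ∈ acc
        then 1 else 0) -
      if tr ω (planted i.2.1 i.1 false i.2.2) (planted i.2.1ᶜ i.1 false i.2.2) ∈ acc
        then 1 else 0) := by
    intro i
    simp only [score, correct, Set.indicator_apply, Set.mem_ofPred_eq, disjoint_planted_iff]
    by_cases ht : tr ω (planted i.2.1 i.1 true i.2.2) (planted i.2.1ᶜ i.1 true i.2.2) ∈ acc <;>
      by_cases hf : tr ω (planted i.2.1 i.1 false i.2.2) (planted i.2.1ᶜ i.1 false i.2.2) ∈ acc <;>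
      simp [ht, hf]
  refine ⟨ω, ?_⟩
  simp only [hgain, Finset.expect_add_distrib, Fintype.expect_const] at hω
  simp only [← Finset.univ_product_univ, Finset.expect_product] at hω
  simp only [plantedAdvantage_eq_expect]
  linarith

variable [Fintype L]

lemma bitHellinger_update_true (S : ι → Bool) (j : ι) :
    bitHellinger (fun w => tr (Function.update S j true ⊓ w) ((Function.update S j true)ᶜ ⊓ w)) j =
      hellingerSq (plantedLaw tr S j false false) (plantedLaw tr S j true false) := by
  simp only [bitHellinger, compl_update, update_inf_update]
  rfl

lemma bitHellinger_update_false (S : ι → Bool) (j : ι) :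
    bitHellinger (fun w => tr (Function.update S j false ⊓ w) ((Function.update S j false)ᶜ ⊓ w))
      j = hellingerSq (plantedLaw tr S j false false) (plantedLaw tr S j false true) := by
  simp only [bitHellinger, compl_update, update_inf_update]
  rfl

lemma HasRectangularFibers.hellingerSq_plantedLaw_le (htr : HasRectangularFibers tr)
    (S : ι → Bool) (j : ι) :
    hellingerSq (plantedLaw tr S j true true) (plantedLaw tr S j false false) ≤
      2 * (hellingerSq (plantedLaw tr S j false false) (plantedLaw tr S j true false) +
        hellingerSq (plantedLaw tr S j false false) (plantedLaw tr S j false true)) := by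
  obtain ⟨α, β, hprod⟩ := htr.plantedLaw_eq_mul S j
  have hnonneg : ∀ u v, 0 ≤ plantedLaw tr S j u v := fun u v l => uniformLaw_nonneg _ l
  -- The cut-and-paste property: the laws for `11`, `00` and for `10`, `01` have the same products.
  rw [hellingerSq_eq_of_mul_eq_mul (hnonneg true true) (hnonneg false false) (hnonneg true false)
    (hnonneg false true) (by simp only [plantedLaw, sum_uniformLaw]) fun l => by
      simp only [hprod]; ring]
  exact hellingerSq_le_two_mul_add ..

lemma HasRectangularFibers.plantedAdvantage_le (htr : HasRectangularFibers tr) (acc : Finset L)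
    (S : ι → Bool) (j : ι) :
    plantedAdvantage tr acc S j ≤ 1 / 6 + 12 *
      (hellingerSq (plantedLaw tr S j false false) (plantedLaw tr S j true false) +
        hellingerSq (plantedLaw tr S j false false) (plantedLaw tr S j false true)) := by
  have hsq := sq_sum_sub_le_hellingerSq (p := plantedLaw tr S j true true)
    (q := plantedLaw tr S j false false) (uniformLaw_nonneg _) (uniformLaw_nonneg _)
    (sum_uniformLaw _) (sum_uniformLaw _) acc
  rw [← plantedAdvantage] at hsq
  -- AM-GM: `t ≤ 1 / 6 + 3 / 2 * t ^ 2`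
  linarith [htr.hellingerSq_plantedLaw_le S j, sq_nonneg (3 * plantedAdvantage tr acc S j - 1)]

theorem HasRectangularFibers.sum_expect_plantedAdvantage_le (htr : HasRectangularFibers tr)
    (acc : Finset L) :
    ∑ j, 𝔼 S, plantedAdvantage tr acc S j ≤
      Fintype.card ι / 6 + 96 * Real.log (Fintype.card L) := by
  let H (S : ι → Bool) (j : ι) : ℝ := bitHellinger (fun w => tr (S ⊓ w) (Sᶜ ⊓ w)) j
  have hadv : ∀ j, 𝔼 S, plantedAdvantage tr acc S j ≤ 1 / 6 + 24 * 𝔼 S, H S j := by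
    intro j
    calc 𝔼 S, plantedAdvantage tr acc S j
        ≤ 𝔼 S, (1 / 6 + 12 * (H (Function.update S j true) j + H (Function.update S j false) j)) :=
          Finset.expect_le_expect fun S _ => by
            simpa only [H, bitHellinger_update_true, bitHellinger_update_false] using
              htr.plantedAdvantage_le acc S j
      _ = 1 / 6 + 12 * (𝔼 S, H (Function.update S j true) j +
            𝔼 S, H (Function.update S j false) j) := by
          rw [Finset.expect_add_distrib, Fintype.expect_const, ← Finset.mul_expect,
            Finset.expect_add_distrib]
      _ = 1 / 6 + 24 * 𝔼 S, H S j := by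
          rw [expect_update_add_expect_update (H · j)]
          ring
  have hH : ∑ j, 𝔼 S, H S j ≤ 4 * Real.log (Fintype.card L) := by
    rw [← Finset.expect_sum_comm]
    exact Finset.expect_le Finset.univ_nonempty fun S _ => sum_bitHellinger_le_log_card _
  calc ∑ j, 𝔼 S, plantedAdvantage tr acc S j ≤ ∑ j, (1 / 6 + 24 * 𝔼 S, H S j) :=
        Finset.sum_le_sum fun j _ => hadv j
    _ = Fintype.card ι / 6 + 24 * ∑ j, 𝔼 S, H S j := by
        rw [Finset.sum_add_distrib, ← Finset.mul_sum, Finset.sum_const, Finset.card_univ,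
          nsmul_eq_mul, mul_one_div]
    _ ≤ Fintype.card ι / 6 + 96 * Real.log (Fintype.card L) := by linarith

end Disjointness

theorem card_le_mul_log_card_of_disjointness {ι L Ω : Type*} [Fintype ι] [Fintype L]
    [MeasurableSpace Ω] {μ : Measure Ω} [IsProbabilityMeasure μ]
    {tr : Ω → (ι → Bool) → (ι → Bool) → L}
    (htr : ∀ ω, HasRectangularFibers (tr ω)) (acc : Finset L)
    (hmeas : ∀ x y, MeasurableSet {ω | tr ω x y ∈ acc ↔ ¬Disjoint x y})
    (hprob : ∀ x y, 2 / 3 ≤ μ.real {ω | tr ω x y ∈ acc ↔ ¬Disjoint x y}) :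
    Fintype.card ι ≤ 576 * Real.log (Fintype.card L) := by
  classical
  cases isEmpty_or_nonempty ι with
  | inl _ => simpa using Real.log_natCast_nonneg _
  | inr _ =>
    obtain ⟨ω, hadv⟩ := exists_le_expect_plantedAdvantage hmeas hprob
    rw [Fintype.expect_eq_sum_div_card, le_div_iff₀ (by exact_mod_cast Fintype.card_pos)] at hadv
    linarith [(htr ω).sum_expect_plantedAdvantage_le acc]

section CutSimulation

/-- A message as a sequence of `b` symbols, where `none` stands for the end of the message. -/
def encodeMessage {b : ℕ} (w : CongestMessage b) (i : Fin b) : Option Bool := w.1[i.1]?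

lemma encodeMessage_injective {b : ℕ} : Function.Injective (encodeMessage (b := b)) := by
  refine fun w w' h => Subtype.ext (List.ext_getElem? fun i => ?_)
  rcases lt_or_ge i b with hi | hi
  · exact congrFun h ⟨i, hi⟩
  · rw [List.getElem?_eq_none (w.2.trans hi), List.getElem?_eq_none (w'.2.trans hi)]

noncomputable instance {b : ℕ} : Fintype (CongestMessage b) :=
  Fintype.ofInjective _ encodeMessage_injective

lemma card_congestMessage_le (b : ℕ) : Fintype.card (CongestMessage b) ≤ 3 ^ b := by
  simpa using Fintype.card_le_of_injective _ (encodeMessage_injective (b := b))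

namespace CongestAlgorithm

variable {n k b : ℕ}

/-- If the runs on the graphs `H v` agree on all messages along the edges of `G`, then they can be
glued to the run on the graph `G` in which the neighborhood of each `v` is that in `H v`. -/
lemma stateAfter_eq_of_send_eq (A : CongestAlgorithm n k b) {G : SimpleGraph (Fin n)}
    {H : Fin n → SimpleGraph (Fin n)} {c : Fin n → Fin k} {T : ℕ}
    (hadj : ∀ u v, G.Adj u v ↔ (H v).Adj u v)
    (hsend : ∀ t < T, ∀ u v, G.Adj u v →
      A.send (A.stateAfter (H u) c t u) v = A.send (A.stateAfter (H v) c t u) v) :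
    ∀ t ≤ T, ∀ v, A.stateAfter G c t v = A.stateAfter (H v) c t v := by
  intro t
  induction t with
  | zero =>
    intro _ v
    have hnbr : G.neighborSet v = (H v).neighborSet v := Set.ext fun u => by
      rw [SimpleGraph.mem_neighborSet, SimpleGraph.mem_neighborSet, G.adj_comm, (H v).adj_comm,
        hadj]
    rw [stateAfter, stateAfter, hnbr]
  | succ t ih =>
    intro ht v
    have hstate := ih (Nat.le_of_succ_le ht)
    rw [stateAfter, stateAfter, hstate v]
    congr 1
    funext u
    by_cases h : G.Adj u v
    · rw [if_pos h, if_pos ((hadj u v).1 h), hstate u, hsend t ht u v h]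
    · rw [if_neg h, if_neg (mt (hadj u v).2 h)]

/-- What the owners of `S` and of its complement exchange in order to simulate `T` rounds: all
messages along the directed edges in `D`, and whether some node on either side accepts. -/
noncomputable def cutTranscript (A : CongestAlgorithm n k b) (c : Fin n → Fin k) (T : ℕ)
    (S : Set (Fin n)) (D : Finset (Fin n × Fin n)) (G : SimpleGraph (Fin n)) :
    (Fin T → D → CongestMessage b) × Prop × Prop :=
  (fun t e => A.send (A.stateAfter G c t e.1.1) e.1.2,
    ∃ v ∈ S, A.output (A.stateAfter G c T v) = true,
    ∃ v ∉ S, A.output (A.stateAfter G c T v) = true)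

lemma acceptsIn_iff_cutTranscript (A : CongestAlgorithm n k b) (c : Fin n → Fin k) (T : ℕ)
    (S : Set (Fin n)) (D : Finset (Fin n × Fin n)) (G : SimpleGraph (Fin n)) :
    A.AcceptsIn T G c ↔ (A.cutTranscript c T S D G).2.1 ∨ (A.cutTranscript c T S D G).2.2 := by
  simp only [AcceptsIn, cutTranscript, ← exists_or, ← or_and_right, em, true_and]

lemma log_card_cutTranscript_le (b T : ℕ) (D : Finset (Fin n × Fin n)) :
    Real.log (Fintype.card ((Fin T → D → CongestMessage b) × Prop × Prop)) ≤
      2 * (b * D.card * T) + 2 := by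
  have hcard : Fintype.card ((Fin T → D → CongestMessage b) × Prop × Prop) ≤
      3 ^ (b * D.card * T) * 2 ^ 2 := by
    rw [Fintype.card_prod, Fintype.card_prod, Fintype.card_prop, Fintype.card_fun, Fintype.card_fun,
      Fintype.card_fin, Fintype.card_coe, pow_mul, pow_mul]
    gcongr
    exacts [card_congestMessage_le b, le_rfl]
  have hpos : 0 < Fintype.card ((Fin T → D → CongestMessage b) × Prop × Prop) :=
    Fintype.card_pos_iff.2 ⟨(fun _ _ => ⟨[], b.zero_le⟩, True, True)⟩
  calc Real.log (Fintype.card ((Fin T → D → CongestMessage b) × Prop × Prop))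
      ≤ Real.log (3 ^ (b * D.card * T) * 2 ^ 2) :=
        Real.log_le_log (by exact_mod_cast hpos) (by exact_mod_cast hcard)
    _ = b * D.card * T * Real.log 3 + 2 * Real.log 2 := by
        rw [Real.log_mul (by positivity) (by positivity), Real.log_pow, Real.log_pow]
        push_cast
        ring
    _ ≤ b * D.card * T * 2 + 2 * 1 := by
        gcongr <;> linarith [Real.log_le_sub_one_of_pos (show (0 : ℝ) < 3 by norm_num),
          Real.log_le_sub_one_of_pos (show (0 : ℝ) < 2 by norm_num)]
    _ = 2 * (b * D.card * T) + 2 := by ring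

/-- A family of graphs that reduces set disjointness to `P`: the two players own the nodes in `S`
and outside `S`, the first one knows `x` and the second one knows `y`, and only the directed edges
in `D` cross between them. -/
structure IsLowerBoundFamily {ι : Type*} (P : ColoredGraphProblem n k)
    (G : (ι → Bool) → (ι → Bool) → SimpleGraph (Fin n)) (c : Fin n → Fin k) (S : Set (Fin n))
    (D : Finset (Fin n × Fin n)) : Prop where
  adj_congr_right : ∀ x y y' u v, v ∈ S → ((G x y).Adj u v ↔ (G x y').Adj u v)
  adj_congr_left : ∀ x x' y u v, v ∉ S → ((G x y).Adj u v ↔ (G x' y).Adj u v)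
  mem_of_adj : ∀ x y u v, (G x y).Adj u v → (u ∈ S ↔ v ∉ S) → (u, v) ∈ D
  iff_not_disjoint : ∀ x y, P (G x y) c ↔ ¬Disjoint x y

namespace IsLowerBoundFamily

variable {ι : Type*} {P : ColoredGraphProblem n k}
  {G : (ι → Bool) → (ι → Bool) → SimpleGraph (Fin n)} {c : Fin n → Fin k} {S : Set (Fin n)}
  {D : Finset (Fin n × Fin n)}

lemma hasRectangularFibers (hG : IsLowerBoundFamily P G c S D) (A : CongestAlgorithm n k b)
    (T : ℕ) : HasRectangularFibers fun x y => A.cutTranscript c T S D (G x y) := by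
  classical
  intro x y x' y' htr
  obtain ⟨hmsg, haccept⟩ := Prod.ext_iff.1 htr
  have hsend : ∀ t < T, ∀ u v, (u, v) ∈ D →
      A.send (A.stateAfter (G x y) c t u) v = A.send (A.stateAfter (G x' y') c t u) v :=
    fun t ht u v huv => congrFun (congrFun hmsg ⟨t, ht⟩) ⟨(u, v), huv⟩
  have hstate : ∀ t ≤ T, ∀ v, A.stateAfter (G x y') c t v =
      A.stateAfter (if v ∈ S then G x y else G x' y') c t v := by
    refine A.stateAfter_eq_of_send_eq (fun u v => ?_) fun t ht u v huv => ?_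
    · split_ifs with hv
      exacts [hG.adj_congr_right x y' y u v hv, hG.adj_congr_left x x' y' u v hv]
    · split_ifs with hu hv hv
      · rfl
      · exact hsend t ht u v (hG.mem_of_adj x y' u v huv (by tauto))
      · exact (hsend t ht u v (hG.mem_of_adj x y' u v huv (by tauto))).symm
      · rfl
  have hS : ∀ v ∈ S, A.stateAfter (G x y') c T v = A.stateAfter (G x y) c T v := fun v hv => by
    rw [hstate T le_rfl v, if_pos hv]
  have hSc : ∀ v ∉ S, A.stateAfter (G x y') c T v = A.stateAfter (G x' y') c T v := fun v hv => by
    rw [hstate T le_rfl v, if_neg hv]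
  refine Prod.ext (funext₂ fun t e => ?_) (Prod.ext ?_ ?_)
  · dsimp only [cutTranscript]
    rw [hstate t t.2.le]
    split_ifs
    exacts [rfl, (hsend t t.2 _ _ e.2).symm]
  · exact propext (exists_congr fun v => and_congr_right fun hv => by rw [hS v hv])
  · exact (propext (exists_congr fun v => and_congr_right fun hv => by rw [hSc v hv])).trans
      (congrArg Prod.snd haccept).symm

/-- An algorithm for `P` yields a protocol for set disjointness that exchanges the messages along
the cut. -/
theorem card_le [Fintype ι] (hG : IsLowerBoundFamily P G c S D) {Ω : Type*} [MeasurableSpace Ω]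
    {μ : Measure Ω} [IsProbabilityMeasure μ] {A : Ω → CongestAlgorithm n k b} {T : ℕ}
    (hA : RandomizedSolvesIn μ A T P) :
    (Fintype.card ι : ℝ) ≤ 576 * (2 * (b * D.card * T) + 2) := by
  classical
  have hset : ∀ x y, {ω | (A ω).cutTranscript c T S D (G x y) ∈
      Finset.univ.filter (fun l => l.2.1 ∨ l.2.2) ↔ ¬Disjoint x y} =
        {ω | (A ω).AcceptsIn T (G x y) c ↔ P (G x y) c} := fun x y => by
    simp only [Finset.mem_filter_univ, hG.iff_not_disjoint, ← acceptsIn_iff_cutTranscript]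
  refine (card_le_mul_log_card_of_disjointness (μ := μ) (fun ω => hG.hasRectangularFibers (A ω) T)
    (Finset.univ.filter fun l => l.2.1 ∨ l.2.2) (fun x y => ?_) fun x y => ?_).trans ?_
  · rw [hset]
    exact (hA (G x y) c).1
  · rw [hset]
    simpa [Measure.real] using ENNReal.toReal_mono (measure_ne_top μ _) (hA (G x y) c).2
  · gcongr
    exact log_card_cutTranscript_le b T D

end IsLowerBoundFamily

lemma SolvesIn.randomizedSolvesIn {A : CongestAlgorithm n k b} {T : ℕ}
    {P : ColoredGraphProblem n k} (hA : A.SolvesIn T P) {Ω : Type*} [MeasurableSpace Ω]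
    (μ : Measure Ω) [IsProbabilityMeasure μ] : RandomizedSolvesIn μ (fun _ => A) T P := by
  intro G c
  simp only [hA G c, Set.ofPred_true, MeasurableSet.univ, measure_univ, true_and]
  exact ENNReal.div_le_of_le_mul (by norm_num)

end CongestAlgorithm

end CutSimulation

section LayeredGraph

lemma cycleGraph_adj_iff {k : ℕ} [NeZero k] (hk : 2 ≤ k) {i j : Fin k} :
    (SimpleGraph.cycleGraph k).Adj i j ↔ j = i + 1 ∨ i = j + 1 := by
  obtain ⟨k, rfl⟩ := Nat.exists_eq_add_of_le' hk
  rw [SimpleGraph.cycleGraph_adj, sub_eq_iff_eq_add', sub_eq_iff_eq_add', or_comm]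

lemma val_add_one_eq_ite {k : ℕ} [NeZero k] (hk : 2 ≤ k) (i : Fin k) :
    ((i + 1 : Fin k) : ℕ) = if i.val + 1 = k then 0 else i.val + 1 := by
  rw [Fin.val_add_eq_ite, Fin.val_one', Nat.mod_eq_of_lt hk]
  split_ifs <;> omega

lemma ne_add_one_add_one {k : ℕ} [NeZero k] (hk : 3 ≤ k) (i : Fin k) : i ≠ i + 1 + 1 := by
  intro h
  have hval := congrArg Fin.val h
  rw [val_add_one_eq_ite (by omega), val_add_one_eq_ite (by omega)] at hval
  split_ifs at hval <;> omega

lemma adj_of_adj_map_of_injective {V : Type*} [Finite V] {G : SimpleGraph V} (f : G →g G)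
    (hf : Function.Injective f) {u v : V} (h : G.Adj (f u) (f v)) : G.Adj u v := by
  obtain ⟨⟨e, he⟩, hfe⟩ := (Finite.injective_iff_surjective.1
    (SimpleGraph.Hom.mapEdgeSet.injective f hf)) ⟨s(f u, f v), h⟩
  obtain rfl : e = s(u, v) := Sym2.map.injective hf (congrArg Subtype.val hfe)
  exact he

variable {k : ℕ} [NeZero k] {α : Type*}

/-- The graph with cyclically arranged layers `{i} × α`, where `R i` prescribes the edges from
layer `i` to layer `i + 1`. -/
def layeredGraph (R : Fin k → α → α → Prop) : SimpleGraph (Fin k × α) :=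
  SimpleGraph.fromRel fun p q => q.1 = p.1 + 1 ∧ R p.1 p.2 q.2

/-- `R` relates some choice of one node in each layer consecutively all the way around. -/
def HasClosedTransversal (R : Fin k → α → α → Prop) : Prop :=
  ∃ a : Fin k → α, ∀ i, R i (a i) (a (i + 1))

lemma layeredGraph_adj_iff (hk : 2 ≤ k) {R : Fin k → α → α → Prop} {p q : Fin k × α} :
    (layeredGraph R).Adj p q ↔
      q.1 = p.1 + 1 ∧ R p.1 p.2 q.2 ∨ p.1 = q.1 + 1 ∧ R q.1 q.2 p.2 := by
  rw [layeredGraph, SimpleGraph.fromRel_adj, and_iff_right_iff_imp]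
  rintro h rfl
  have hval : p.1 = p.1 + 1 := by tauto
  have := congrArg Fin.val hval
  rw [val_add_one_eq_ite hk] at this
  split_ifs at this <;> omega

lemma layeredGraph_adj_congr {R R' : Fin k → α → α → Prop} {p : Fin k × α}
    (hR : R p.1 = R' p.1) (hR' : ∀ i, i + 1 = p.1 → R i = R' i) (q : Fin k × α) :
    (layeredGraph R).Adj q p ↔ (layeredGraph R').Adj q p := by
  simp only [layeredGraph, SimpleGraph.fromRel_adj, hR]
  refine and_congr_right fun _ => or_congr_left (and_congr_right fun h => ?_)
  rw [hR' q.1 h.symm]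

lemma HasClosedTransversal.exists_embedding (hk : 2 ≤ k) {R : Fin k → α → α → Prop}
    (hR : HasClosedTransversal R) :
    ∃ φ : SimpleGraph.cycleGraph k ↪g layeredGraph R, ∀ i, (φ i).1 = i := by
  obtain ⟨a, ha⟩ := hR
  refine ⟨⟨⟨fun i => (i, a i), fun i j h => congrArg Prod.fst h⟩, fun {i j} => ?_⟩, fun i => rfl⟩
  refine (layeredGraph_adj_iff hk).trans (Iff.trans ?_ (cycleGraph_adj_iff hk).symm)
  refine or_congr (and_iff_left_of_imp ?_) (and_iff_left_of_imp ?_) <;> rintro rfl <;> exact ha _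

lemma hasClosedTransversal_of_hom (hk : 3 ≤ k) {R : Fin k → α → α → Prop}
    (φ : SimpleGraph.cycleGraph k →g layeredGraph R)
    (hφ : Function.Injective fun i => (φ i).1) : HasClosedTransversal R := by
  have hk2 : 2 ≤ k := by omega
  let σ : SimpleGraph.cycleGraph k →g SimpleGraph.cycleGraph k :=
    ⟨fun i => (φ i).1, fun h => (cycleGraph_adj_iff hk2).2 <|
      ((layeredGraph_adj_iff hk2).1 (φ.map_adj h)).imp And.left And.left⟩
  obtain ⟨τ, hτ⟩ := (Finite.injective_iff_surjective.1 hφ).hasRightInverse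
  refine ⟨fun i => (φ (τ i)).2, fun i => ?_⟩
  have hadj : (SimpleGraph.cycleGraph k).Adj (τ i) (τ (i + 1)) := by
    refine adj_of_adj_map_of_injective σ hφ ((cycleGraph_adj_iff hk2).2 (.inl ?_))
    exact (hτ (i + 1)).trans (congrArg (· + 1) (hτ i).symm)
  have hlayer := (layeredGraph_adj_iff hk2).1 (φ.map_adj hadj)
  rw [show (φ (τ i)).1 = i from hτ i, show (φ (τ (i + 1))).1 = i + 1 from hτ (i + 1)] at hlayer
  exact hlayer.elim And.right fun h => absurd h.1 (ne_add_one_add_one hk i)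

end LayeredGraph

section Colored

variable {n k : ℕ}

lemma HasMulticoloredInducedCycle.hasMulticoloredCycle {G : SimpleGraph (Fin n)}
    {c : Fin n → Fin k} (h : HasMulticoloredInducedCycle n k G c) : HasMulticoloredCycle n k G c :=
  let ⟨φ, hφ⟩ := h
  ⟨φ.toCopy, hφ⟩

variable [NeZero k] {α : Type*} {R : Fin k → α → α → Prop} {f : Fin k × α ↪ Fin n}
  {c : Fin n → Fin k}

lemma HasClosedTransversal.hasMulticoloredInducedCycle_map (hk : 2 ≤ k)
    (hc : ∀ p, c (f p) = p.1) (hR : HasClosedTransversal R) :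
    HasMulticoloredInducedCycle n k ((layeredGraph R).map f) c := by
  obtain ⟨φ, hφ⟩ := hR.exists_embedding hk
  refine ⟨(SimpleGraph.Embedding.map f _).comp φ, fun i j hij => ?_⟩
  simpa [hc, hφ] using hij

lemma HasMulticoloredCycle.hasClosedTransversal_of_map (hk : 3 ≤ k) (hc : ∀ p, c (f p) = p.1)
    (h : HasMulticoloredCycle n k ((layeredGraph R).map f) c) : HasClosedTransversal R := by
  obtain ⟨φ, hφ⟩ := h
  have hrange : ∀ i, ∃ p, f p = φ i := fun i => by
    obtain ⟨p, -, -, hp, -⟩ := (SimpleGraph.map_adj f _ _ _).1 <|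
      φ.toHom.map_adj ((cycleGraph_adj_iff (by omega : 2 ≤ k)).2 (.inl (rfl : i + 1 = i + 1)))
    exact ⟨p, hp⟩
  choose p hp using hrange
  refine hasClosedTransversal_of_hom hk ⟨p, fun {i j} hij => ?_⟩ fun i j hij => hφ ?_
  · have := φ.toHom.map_adj hij
    rwa [φ.coe_toHom, ← hp i, ← hp j, SimpleGraph.map_adj_apply] at this
  · simp only [← hp, hc]
    exact hij

end Colored

section LowerBoundGraph

variable {k m : ℕ}

/-- The edges of the hard instances: the bipartite graph `x` from layer `0` to layer `1`, the
bipartite graph `y` from layer `3` back to layer `2`, and perfect matchings between the other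
consecutive layers. -/
def intersectionRel (x y : Fin m × Fin m → Bool) (i : Fin k) (a b : Fin m) : Prop :=
  if i.val = 0 then x (a, b) = true else if i.val = 2 then y (b, a) = true else a = b

lemma intersectionRel_congr_left {x x' : Fin m × Fin m → Bool} (y : Fin m × Fin m → Bool)
    {i : Fin k} (hi : i.val ≠ 0) : intersectionRel x y i = intersectionRel x' y i := by
  funext a b
  simp only [intersectionRel, if_neg hi]

lemma intersectionRel_congr_right (x : Fin m × Fin m → Bool) {y y' : Fin m × Fin m → Bool}
    {i : Fin k} (hi : i.val ≠ 2) : intersectionRel x y i = intersectionRel x y' i := by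
  funext a b
  simp only [intersectionRel, if_neg hi]

lemma intersectionRel_iff_eq {x y : Fin m × Fin m → Bool} {i : Fin k} (hi₀ : i.val ≠ 0)
    (hi₂ : i.val ≠ 2) {a b : Fin m} : intersectionRel x y i a b ↔ a = b := by
  rw [intersectionRel, if_neg hi₀, if_neg hi₂]

lemma not_disjoint_iff_exists_eq_true {ι : Type*} {x y : ι → Bool} :
    ¬Disjoint x y ↔ ∃ i, x i = true ∧ y i = true := by
  rw [disjoint_iff, ← ne_eq, Function.ne_iff]
  simp

variable [NeZero k]

lemma apply_eq_apply_zero_of_forall_eq_add_one {α : Type*} {a : Fin k → α} {r : ℕ} (hk : 2 ≤ k)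
    (ha : ∀ i : Fin k, r ≤ i.val → a i = a (i + 1)) (i : Fin k) (hi : r ≤ i.val) : a i = a 0 := by
  rw [ha i hi]
  by_cases hlast : i.val + 1 = k
  · rw [Fin.ext (((val_add_one_eq_ite hk i).trans (if_pos hlast)).trans (Fin.val_zero k).symm)]
  · have hval := (val_add_one_eq_ite hk i).trans (if_neg hlast)
    exact apply_eq_apply_zero_of_forall_eq_add_one hk ha (i + 1) (by omega)
termination_by k - i.val

lemma hasClosedTransversal_intersectionRel_iff (hk : 4 ≤ k) {x y : Fin m × Fin m → Bool} :
    HasClosedTransversal (intersectionRel (k := k) x y) ↔ ¬Disjoint x y := by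
  have hk2 : 2 ≤ k := by omega
  rw [not_disjoint_iff_exists_eq_true]
  constructor
  · rintro ⟨a, ha⟩
    have hsucc : ∀ (j : ℕ) (hj : j + 1 < k),
        intersectionRel x y ⟨j, Nat.lt_of_succ_lt hj⟩ (a ⟨j, Nat.lt_of_succ_lt hj⟩)
          (a ⟨j + 1, hj⟩) := fun j hj => by
      convert ha ⟨j, Nat.lt_of_succ_lt hj⟩ using 2
      rw [Fin.ext_iff, val_add_one_eq_ite hk2, if_neg hj.ne]
    have hx : x (a 0, a ⟨1, by omega⟩) = true := hsucc 0 (by omega)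
    have hmatch : a ⟨1, by omega⟩ = a ⟨2, by omega⟩ := hsucc 1 (by omega)
    have hy : y (a ⟨3, by omega⟩, a ⟨2, by omega⟩) = true := hsucc 2 (by omega)
    have hback : a ⟨3, by omega⟩ = a 0 := apply_eq_apply_zero_of_forall_eq_add_one (r := 3) hk2
      (fun i hi => (intersectionRel_iff_eq (by omega) (by omega)).1 (ha i)) _ le_rfl
    exact ⟨(a 0, a ⟨1, by omega⟩), hx, by rwa [hmatch, ← hback]⟩
  · rintro ⟨⟨p, q⟩, hx, hy⟩
    refine ⟨fun i => if i.val = 1 ∨ i.val = 2 then q else p, fun i => ?_⟩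
    have hlt := i.is_lt
    simp only [intersectionRel, val_add_one_eq_ite hk2]
    split_ifs <;> first | assumption | rfl | omega | tauto

variable {n : ℕ}

/-- The directed edges, after the embedding `f`, of the two matchings that join the layers `0` and
`1` to the other layers. -/
def cutEdges (f : Fin k × Fin m ↪ Fin n) : Finset (Fin n × Fin n) :=
  let matched := (({1, -1} : Finset (Fin k)) ×ˢ Finset.univ).image
    fun p => (f p, f (p.1 + 1, p.2))
  matched ∪ matched.image Prod.swap

lemma card_cutEdges_le (f : Fin k × Fin m ↪ Fin n) : (cutEdges f).card ≤ 4 * m := by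
  have hmatched : ((({1, -1} : Finset (Fin k)) ×ˢ Finset.univ).image
      fun p => (f p, f (p.1 + 1, p.2))).card ≤ 2 * m := by
    refine Finset.card_image_le.trans ?_
    rw [Finset.card_product, Finset.card_univ, Fintype.card_fin]
    exact Nat.mul_le_mul_right m Finset.card_le_two
  calc (cutEdges f).card ≤ _ + _ := Finset.card_union_le ..
    _ ≤ 2 * m + 2 * m := Nat.add_le_add hmatched (Finset.card_image_le.trans hmatched)
    _ = 4 * m := by ring

lemma mem_cutEdges_of_intersectionRel (hk : 4 ≤ k) (f : Fin k × Fin m ↪ Fin n)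
    {x y : Fin m × Fin m → Bool} {p q : Fin k × Fin m} (hpq : q.1 = p.1 + 1)
    (hR : intersectionRel x y p.1 p.2 q.2) (hcut : p.1.val < 2 ↔ ¬q.1.val < 2) :
    (f p, f q) ∈ cutEdges f ∧ (f q, f p) ∈ cutEdges f := by
  obtain ⟨i, a⟩ := p
  obtain ⟨j, b⟩ := q
  dsimp only at hpq hR hcut
  subst hpq
  have hval := val_add_one_eq_ite (by omega) i
  have hi : i = 1 ∨ i = -1 := by
    rw [← Fin.val_inj, Fin.val_one', Nat.mod_eq_of_lt (by omega), eq_neg_iff_add_eq_zero,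
      ← Fin.val_inj (b := 0), Fin.val_zero]
    split_ifs at hval <;> omega
  obtain rfl : a = b := by
    refine (intersectionRel_iff_eq ?_ ?_).1 hR <;> split_ifs at hval <;> omega
  have hmem : (f (i, a), f (i + 1, a)) ∈ (({1, -1} : Finset (Fin k)) ×ˢ Finset.univ).image
      fun p => (f p, f (p.1 + 1, p.2)) :=
    Finset.mem_image_of_mem (fun p : Fin k × Fin m => (f p, f (p.1 + 1, p.2)))
      (a := (i, a)) (by simpa using hi)
  exact ⟨Finset.mem_union_left _ hmem,
    Finset.mem_union_right _ (Finset.mem_image_of_mem Prod.swap hmem)⟩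

lemma map_adj_congr {V W : Type*} {f : V ↪ W} {G G' : SimpleGraph V} {v : W}
    (h : ∀ p, f p = v → ∀ q, (G.Adj q p ↔ G'.Adj q p)) (u : W) :
    (G.map f).Adj u v ↔ (G'.map f).Adj u v := by
  simp only [SimpleGraph.map_adj]
  exact exists₂_congr fun q p => ⟨fun ⟨hqp, hq, hp⟩ => ⟨(h p hp q).1 hqp, hq, hp⟩,
    fun ⟨hqp, hq, hp⟩ => ⟨(h p hp q).2 hqp, hq, hp⟩⟩

theorem isLowerBoundFamily_layeredGraph (hk : 4 ≤ k) {f : Fin k × Fin m ↪ Fin n}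
    {c : Fin n → Fin k} (hc : ∀ p, c (f p) = p.1) {P : ColoredGraphProblem n k}
    (hind : ∀ G c, HasMulticoloredInducedCycle n k G c → P G c)
    (hcyc : ∀ G c, P G c → HasMulticoloredCycle n k G c) :
    CongestAlgorithm.IsLowerBoundFamily P
      (fun x y => (layeredGraph (intersectionRel x y)).map f) c (f '' {p | p.1.val < 2})
      (cutEdges f) where
  adj_congr_right x y y' u v hv := by
    refine map_adj_congr ?_ u
    rintro p rfl
    have hp : p.1.val < 2 := by simpa [f.injective.mem_set_image] using hv
    refine layeredGraph_adj_congr (intersectionRel_congr_right x (by omega)) fun i hi =>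
      intersectionRel_congr_right x ?_
    rw [← hi, val_add_one_eq_ite (by omega)] at hp
    split_ifs at hp <;> omega
  adj_congr_left x x' y u v hv := by
    refine map_adj_congr ?_ u
    rintro p rfl
    have hp : ¬p.1.val < 2 := by simpa [f.injective.mem_set_image] using hv
    refine layeredGraph_adj_congr (intersectionRel_congr_left y (by omega)) fun i hi =>
      intersectionRel_congr_left y ?_
    rw [← hi, val_add_one_eq_ite (by omega)] at hp
    split_ifs at hp <;> omega
  mem_of_adj x y u v huv hcut := by
    obtain ⟨p, q, hpq, rfl, rfl⟩ := (SimpleGraph.map_adj ..).1 huv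
    simp only [f.injective.mem_set_image, Set.mem_ofPred_eq] at hcut
    obtain ⟨hstep, hR⟩ | ⟨hstep, hR⟩ := (layeredGraph_adj_iff (by omega)).1 hpq
    · exact (mem_cutEdges_of_intersectionRel hk f hstep hR hcut).1
    · exact (mem_cutEdges_of_intersectionRel hk f hstep hR (by tauto)).2
  iff_not_disjoint x y := by
    rw [← hasClosedTransversal_intersectionRel_iff hk]
    exact ⟨fun h => (hcyc _ _ h).hasClosedTransversal_of_map (by omega) hc,
      fun h => hind _ _ (h.hasMulticoloredInducedCycle_map (by omega) hc)⟩

end LowerBoundGraph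

theorem exists_isLowerBoundFamily {n k m : ℕ} (hk : 4 ≤ k) (hkm : k * m ≤ n)
    {P : ColoredGraphProblem n k} (hind : ∀ G c, HasMulticoloredInducedCycle n k G c → P G c)
    (hcyc : ∀ G c, P G c → HasMulticoloredCycle n k G c) :
    ∃ (G : (Fin m × Fin m → Bool) → (Fin m × Fin m → Bool) → SimpleGraph (Fin n))
      (c : Fin n → Fin k) (S : Set (Fin n)) (D : Finset (Fin n × Fin n)),
      CongestAlgorithm.IsLowerBoundFamily P G c S D ∧ D.card ≤ 4 * m := by
  have : NeZero k := ⟨by omega⟩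
  let f : Fin k × Fin m ↪ Fin n := finProdFinEquiv.toEmbedding.trans (Fin.castLEEmb hkm)
  exact ⟨_, Function.extend f Prod.fst 0, _, cutEdges f,
    isLowerBoundFamily_layeredGraph hk (f.injective.extend_apply Prod.fst 0) hind hcyc,
    card_cutEdges_le f⟩

theorem mainTheorem11_general {n k b : ℕ} (hk : 4 ≤ k) (hn : 48 * k ≤ n)
    {P : ColoredGraphProblem n k} (hind : ∀ G c, HasMulticoloredInducedCycle n k G c → P G c)
    (hcyc : ∀ G c, P G c → HasMulticoloredCycle n k G c) {Ω : Type*} [MeasurableSpace Ω]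
    {μ : Measure Ω} [IsProbabilityMeasure μ] {A : Ω → CongestAlgorithm n k b} {T : ℕ}
    (hA : CongestAlgorithm.RandomizedSolvesIn μ A T P) : (n : ℝ) ≤ 18432 * k * (b * T) := by
  set m := n / k
  have hk₀ : 0 < k := by omega
  have hm48 : (48 : ℝ) ≤ m := by exact_mod_cast (Nat.le_div_iff_mul_le hk₀).2 hn
  have hnm : (n : ℝ) ≤ k * (m + 1) := by exact_mod_cast (Nat.lt_mul_div_succ n hk₀).le
  obtain ⟨G, c, S, D, hG, hD⟩ := exists_isLowerBoundFamily hk (Nat.mul_div_le n k) hind hcyc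
  have hcard : (m : ℝ) * m ≤ 576 * (2 * (b * D.card * T) + 2) := by
    simpa using hG.card_le hA
  have hD' : (D.card : ℝ) ≤ 4 * m := by exact_mod_cast hD
  have hbits : (m : ℝ) * m ≤ 576 * (2 * (b * (4 * m) * T) + 2) := hcard.trans (by gcongr)
  have hmT : (m : ℝ) ≤ 9216 * (b * T) :=
    le_of_mul_le_mul_left (by nlinarith) (by linarith : (0 : ℝ) < m)
  calc (n : ℝ) ≤ k * (m + 1) := hnm
    _ ≤ k * (2 * (9216 * (b * T))) := by gcongr; linarith
    _ = 18432 * k * (b * T) := by ring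

theorem mainTheorem11 (k : ℕ) (hk : 4 ≤ k) (C : ℝ) (hC : 0 < C) :
    ∃ α : ℝ, 0 < α ∧ ∃ n₀ : ℕ, ∀ n : ℕ, n₀ ≤ n → ∀ b : ℕ, (b : ℝ) ≤ C * Real.log n →
      (∀ (A : CongestAlgorithm n k b) (T : ℕ),
        A.SolvesIn T (HasMulticoloredCycle n k) ∨
          A.SolvesIn T (HasMulticoloredInducedCycle n k) →
        α * (n / Real.log n) ≤ T) ∧
      (∀ (Ω : Type*) [MeasurableSpace Ω] (μ : Measure Ω) [IsProbabilityMeasure μ]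
          (A : Ω → CongestAlgorithm n k b) (T : ℕ),
        CongestAlgorithm.RandomizedSolvesIn μ A T (HasMulticoloredCycle n k) ∨
          CongestAlgorithm.RandomizedSolvesIn μ A T (HasMulticoloredInducedCycle n k) →
        α * (n / Real.log n) ≤ T) := by
  have : (0 : ℝ) < k := by exact_mod_cast (by omega : 0 < k)
  refine ⟨(18432 * k * C)⁻¹, by positivity, 48 * k, fun n hn b hb => ?_⟩
  have hlog : 0 < Real.log n := Real.log_pos (by exact_mod_cast (by omega : 1 < n))
  have of_le_mul {T : ℕ} (h : (n : ℝ) ≤ 18432 * k * (b * T)) :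
      (18432 * k * C)⁻¹ * (n / Real.log n) ≤ T := by
    rw [inv_mul_le_iff₀ (by positivity), div_le_iff₀ hlog]
    calc (n : ℝ) ≤ 18432 * k * (C * Real.log n * T) := h.trans (by gcongr)
      _ = 18432 * k * C * T * Real.log n := by ring
  refine (and_iff_right_of_imp fun randomized A T hA => ?_).2 fun Ω _ μ _ A T hA => of_le_mul ?_
  · exact randomized PUnit (.dirac .unit) (fun _ => A) T
      (hA.imp (·.randomizedSolvesIn _) (·.randomizedSolvesIn _))
  · have of_induced := @HasMulticoloredInducedCycle.hasMulticoloredCycle n k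
    exact hA.elim (mainTheorem11_general hk hn (fun _ _ => of_induced) fun _ _ => id)
      (mainTheorem11_general hk hn (fun _ _ => id) fun _ _ => of_induced)
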